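/- **Definitions.** For $\tau\ge 1$, a map $f\colon (Y,d_Y)\to(Z,d_Z)$ of metric spaces is a *$\tau$-quasi-isometric embedding* if $\tau^{-1}d_Y(x,y)-\tau\le d_Z(f(x),f(y))\le \tau d_Y(x,y)+\tau$ for all $x,y\in Y$; it is a *quasi-isometric embedding* if this holds for some $\tau\ge1$. A *$\tau$-quasi-geodesic* is a (not necessarily continuous) $\tau$-quasi-isometric embedding of an interval of $\mathbb R$. A finitely generated group is equipped with the word metric of a finite generating set. A *Gromov hyperbolic* space is a geodesic metric space all of whose geodesic triangles are $\delta$-slim for some $\delta$. Let $G$ be a group, $H\le G$ a subgroup and $X$ a Gromov hyperbolic space on which $G$ acts by isometries. Then $(G,X,H)$ is an *A/QI triple* if $H$ is finitely generated and infinite and * (A) the action is acylindrical along $H$: for some $x\in X$, for every $\varepsilon\ge0$ there are $R>0$ and $M>0$ such that for all $y,z\in Hx$ with $d(y,z)\ge R$, $\#\{g\in G\mid d(gy,y)\le\varepsilon\text{ and }d(gz,z)\le\varepsilon\}\le M$; * (QI) $H$ is quasi-isometrically embedded by the action: for some $x\in X$, the map $H\to X$, $h\mapsto hx$, is a quasi-isometric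 embedding (for the word metric of some finite generating set of $H$). A finitely generated subgroup $H$ of a finitely generated group $G$ is *stable* in $G$ if it is undistorted (for all finite generating sets of $H$ and of $G$, the inclusion $H\hookrightarrow G$ is a quasi-isometric embedding of word metrics) and, for every finite generating set $S$ of $G$ and every $\tau\ge1$, there is $L=L(S,\tau)\ge 0$ such that any two $\tau$-quasi-geodesics $\gamma_1,\gamma_2$ in $G$, parametrized by compact intervals and having the same endpoints, both lying in $H$, are at Hausdorff distance at most $L$ from each other. **Theorem 1.3.** Let $(G,X,H)$ be an A/QI triple, and suppose that $G$ is finitely generated. Then $H$ is stable in $G$. -/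

import Mathlib

open scoped NNReal ENNReal

namespace AQI

/-! ### Coarse geometry of metric spaces -/

section Metric

/-- `f` is a `τ`-quasi-isometric embedding (multiplicative and additive constants bundled
into the single number `τ ≥ 1`). -/
def IsQIEmbeddingWith {X Y : Type*} [PseudoMetricSpace X] [PseudoMetricSpace Y]
    (τ : ℝ) (f : X → Y) : Prop :=
  1 ≤ τ ∧ ∀ x y : X,
    τ⁻¹ * dist x y - τ ≤ dist (f x) (f y) ∧ dist (f x) (f y) ≤ τ * dist x y + τ

/-- `f` is a quasi-isometric embedding. -/
def IsQIEmbedding {X Y : Type*} [PseudoMetricSpace X] [PseudoMetricSpace Y]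
    (f : X → Y) : Prop :=
  ∃ τ : ℝ, IsQIEmbeddingWith τ f

/-- `γ` restricted to the interval `I ⊆ ℝ` is a `τ`-quasi-geodesic (not necessarily continuous);
the values of `γ` outside `I` are irrelevant. -/
def IsQuasiGeodesic {Y : Type*} [PseudoMetricSpace Y]
    (τ : ℝ) (I : Set ℝ) (γ : ℝ → Y) : Prop :=
  IsConnected I ∧ IsQIEmbeddingWith τ (I.domRestrict γ)

/-- `γ` restricted to `[0, dist x y]` is a geodesic segment from `x` to `y`. -/
def IsGeodesic {X : Type*} [MetricSpace X] (x y : X) (γ : ℝ → X) : Prop :=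
  γ 0 = x ∧ γ (dist x y) = y ∧
    ∀ s ∈ Set.Icc 0 (dist x y), ∀ t ∈ Set.Icc 0 (dist x y), dist (γ s) (γ t) = |s - t|

/-- Any two points are joined by a geodesic segment. -/
def IsGeodesicSpace (X : Type*) [MetricSpace X] : Prop :=
  ∀ x y : X, ∃ γ : ℝ → X, IsGeodesic x y γ

/-- Every geodesic triangle is `δ`-slim: each side is contained in the (closed)
`δ`-neighbourhood of the union of the two other sides. As the vertices are arbitrary, it is
enough to require this for the side from `x` to `y`. -/
def SlimTriangles (δ : ℝ) (X : Type*) [MetricSpace X] : Prop :=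
  ∀ (x y z : X) (α β γ : ℝ → X), IsGeodesic x y α → IsGeodesic y z β → IsGeodesic x z γ →
    ∀ p ∈ α '' Set.Icc 0 (dist x y),
      ∃ q ∈ β '' Set.Icc 0 (dist y z) ∪ γ '' Set.Icc 0 (dist x z), dist p q ≤ δ

/-- A Gromov hyperbolic geodesic metric space. -/
def IsGromovHyperbolic (X : Type*) [MetricSpace X] : Prop :=
  IsGeodesicSpace X ∧ ∃ δ : ℝ, SlimTriangles δ X

end Metric

/-! ### Word metrics -/

section Word

/-- If `S` generates `G`, then the Cayley graph of `G` with respect to `S` is connected. -/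
theorem connected_mulCayley {G : Type*} [Group G] {S : Set G}
    (hS : Subgroup.closure S = ⊤) : (SimpleGraph.mulCayley S).Connected := by
  have step : ∀ x : G, ∀ s ∈ S, (SimpleGraph.mulCayley S).Reachable x (x * s) := by
    intro x s hs
    by_cases h : x = x * s
    · rw [← h]
    · exact SimpleGraph.Adj.reachable
        ((SimpleGraph.mulCayley_adj S x (x * s)).2 ⟨h, Or.inl (by simpa using hs)⟩)
  have key : ∀ g : G, (SimpleGraph.mulCayley S).Reachable 1 g := by
    intro g
    have hg : g ∈ Subgroup.closure S := by rw [hS]; trivial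
    induction hg using Subgroup.closure_induction_right with
    | one => exact SimpleGraph.Reachable.refl _
    | mul_right x _ y hy ih => exact ih.trans (step x y hy)
    | mul_inv_cancel x _ y hy ih =>
      refine ih.trans (SimpleGraph.Reachable.symm ?_)
      simpa using step (x * y⁻¹) y hy
  have : Nonempty G := ⟨1⟩
  exact ⟨fun x y => (key x).symm.trans (key y)⟩

/-- The group `G` equipped with the word metric of the generating set `S`. -/
def WordSpace {G : Type*} [Group G] (S : Set G) (_hS : Subgroup.closure S = ⊤) : Type _ := G

/-- The identity map from `G` to `G` with the word metric. -/
def WordSpace.of {G : Type*} [Group G] (S : Set G) (hS : Subgroup.closure S = ⊤) :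
    G ≃ WordSpace S hS :=
  Equiv.refl G

/-- The word metric: the path metric of the Cayley graph (edges `g — g s`, `s ∈ S`),
restricted to its vertex set. -/
noncomputable instance {G : Type*} [Group G] (S : Set G) (hS : Subgroup.closure S = ⊤) :
    MetricSpace (WordSpace S hS) where
  dist x y :=
    ((SimpleGraph.mulCayley S).dist ((WordSpace.of S hS).symm x) ((WordSpace.of S hS).symm y) : ℝ)
  dist_self x := by simp
  dist_comm x y := by rw [SimpleGraph.dist_comm]
  dist_triangle x y z := by exact_mod_cast (connected_mulCayley hS).dist_triangle
  eq_of_dist_eq_zero {x y} h := by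
    have h' := (connected_mulCayley hS).dist_eq_zero_iff.1 (Nat.cast_eq_zero.1 h)
    exact (WordSpace.of S hS).symm.injective h'

end Word

/-! ### A/QI triples -/

section Triples

/-- The action of `G` on `X` is acylindrical along the subset `Y` of `X`. -/
def AcylindricalAlong (G : Type*) {X : Type*} [Group G] [MetricSpace X] [MulAction G X]
    (Y : Set X) : Prop :=
  ∀ ε : ℝ, 0 ≤ ε → ∃ R : ℝ, 0 < R ∧ ∃ M : ℕ, 0 < M ∧
    ∀ x ∈ Y, ∀ y ∈ Y, R ≤ dist x y →
      {g : G | dist (g • x) x ≤ ε ∧ dist (g • y) y ≤ ε}.encard ≤ (M : ℕ∞)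

/-- The action of `G` on `X` is acylindrical along the subgroup `H`: it is acylindrical along
the orbit `H x` for some `x`. -/
def AcylindricalAlongSubgroup {G : Type*} (X : Type*) [Group G] [MetricSpace X] [MulAction G X]
    (H : Subgroup G) : Prop :=
  ∃ x : X, AcylindricalAlong G (MulAction.orbit H x)

/-- The subgroup `H` is quasi-isometrically embedded by the action on `X`: for some finite
generating set `T` of `H` and some point `x`, the orbit map `h ↦ h x` is a quasi-isometric
embedding with respect to the word metric of `T`. -/
def QIEmbeddedByAction {G : Type*} (X : Type*) [Group G] [MetricSpace X] [MulAction G X]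
    (H : Subgroup G) : Prop :=
  ∃ (T : Set H) (hT : Subgroup.closure T = ⊤) (x : X), T.Finite ∧
    IsQIEmbedding (fun h : WordSpace T hT => (WordSpace.of T hT).symm h • x)

/-- `(G, X, H)` is an A/QI triple. -/
structure IsAQITriple (G X : Type*) [Group G] [MetricSpace X] [MulAction G X]
    [IsIsometricSMul G X] (H : Subgroup G) : Prop where
  hyperbolic : IsGromovHyperbolic X
  fg : H.FG
  infinite : Infinite H
  acylindrical : AcylindricalAlongSubgroup X H
  qiEmbedded : QIEmbeddedByAction X H

end Triples

/-! ### Stable subgroups -/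

section Stable

/-- The subgroup `H` is undistorted in `G`: for all finite generating sets `T` of `H` and
`S` of `G`, the inclusion is a quasi-isometric embedding of word metrics. -/
def IsUndistorted {G : Type*} [Group G] (H : Subgroup G) : Prop :=
  ∀ (T : Set H) (hT : Subgroup.closure T = ⊤) (S : Set G) (hS : Subgroup.closure S = ⊤),
    T.Finite → S.Finite →
      IsQIEmbedding (fun h : WordSpace T hT =>
        WordSpace.of S hS ((WordSpace.of T hT).symm h : G))

/-- `H` is a stable subgroup of `G`: both are finitely generated, `H` is undistorted, and for
every finite generating set `S` of `G` and every `τ ≥ 1` there is `L` such that any two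
`τ`-quasi-geodesics of `G` (with the word metric of `S`) which have the same endpoints, lying in
`H`, are at Hausdorff distance at most `L`. -/
structure IsStable {G : Type*} [Group G] (H : Subgroup G) : Prop where
  group_fg : Group.FG G
  fg : H.FG
  undistorted : IsUndistorted H
  hausdorff : ∀ (S : Set G) (hS : Subgroup.closure S = ⊤), S.Finite →
    ∀ τ : ℝ, 1 ≤ τ → ∃ L : ℝ≥0,
      ∀ (a b a' b' : ℝ) (γ γ' : ℝ → WordSpace S hS), a ≤ b → a' ≤ b' →
        IsQuasiGeodesic τ (Set.Icc a b) γ → IsQuasiGeodesic τ (Set.Icc a' b') γ' →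
        γ a = γ' a' → γ b = γ' b' →
        (WordSpace.of S hS).symm (γ a) ∈ H → (WordSpace.of S hS).symm (γ b) ∈ H →
        Metric.hausdorffEDist (γ '' Set.Icc a b) (γ' '' Set.Icc a' b') ≤ (L : ℝ≥0∞)

end Stable

end AQI

/-! Write `x` for the base point and project each `g` in `G` to a point of `H` whose image in `X` is
nearly nearest to `g • x`. The heart of the proof is that this projection is contracting
(`isContracting_orbit`): there is one `R` such that, for every `L`, two elements of `G` at word
distance at most `L` and far enough from `H` have projections at most `R` apart in `X`. It matters
that `R` does not depend on `L`. Suppose the projections `h`, `h'` of `g`, `g'` are further apart.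
By hyperbolicity and quasiconvexity of the orbit, the path through `g • x`, `h • x`, `h' • x`, `g' •
x` is almost geodesic (`FourPoint.projection`). After translating by `h⁻¹`, a segment with ends `h⁻¹
* g` and `h⁻¹ * g'` passes near two distant orbit points. Acylindricity allows finitely many such
translates (`AcylindricalAlong.finite_translates`), so `g` is within a bounded word distance of `h`.
Contraction keeps quasi-geodesics of `G` with ends in `H` close to `H` (`IsContracting.seq_near`).
They can then be pushed into `H` and mapped to `X`, where the Morse lemma compares them
(`IsContracting.seq_near_seq`). Undistortion follows because the orbit map of `G` is Lipschitz. -/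

namespace AQI

/-! ### Hyperbolic spaces: four-point condition, Morse lemma, projections. -/

section Hyperbolic

/-- The four-point condition of Gromov. -/
def FourPoint (δ : ℝ) (X : Type*) [MetricSpace X] : Prop :=
  ∀ x y z w : X,
    dist x z + dist y w ≤ max (dist x y + dist z w) (dist x w + dist y z) + δ

variable {X : Type*} [MetricSpace X]

theorem IsGeodesic.dist_left {x y : X} {α : ℝ → X} (h : IsGeodesic x y α) {t : ℝ}
    (ht : t ∈ Set.Icc 0 (dist x y)) : dist x (α t) = t := by
  have := h.2.2 0 ⟨le_rfl, dist_nonneg⟩ t ht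
  rw [h.1] at this
  rw [this, zero_sub, abs_neg, abs_of_nonneg ht.1]

theorem IsGeodesic.dist_right {x y : X} {α : ℝ → X} (h : IsGeodesic x y α) {t : ℝ}
    (ht : t ∈ Set.Icc 0 (dist x y)) : dist (α t) y = dist x y - t := by
  have := h.2.2 t ht _ ⟨dist_nonneg, le_rfl⟩
  rw [h.2.1] at this
  rw [this, abs_sub_comm, abs_of_nonneg (sub_nonneg.2 ht.2)]

theorem IsGeodesic.continuousOn {x y : X} {α : ℝ → X} (h : IsGeodesic x y α) :
    ContinuousOn α (Set.Icc 0 (dist x y)) := by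
  have : LipschitzOnWith 1 α (Set.Icc 0 (dist x y)) :=
    LipschitzOnWith.of_dist_le_mul fun s hs t ht => by
      rw [h.2.2 s hs t ht, Real.dist_eq]; simp
  exact this.continuousOn

theorem SlimTriangles.nonneg {δ : ℝ} (hs : SlimTriangles δ X) (x : X) : 0 ≤ δ := by
  have hg : IsGeodesic x x (fun _ => x) := by
    refine ⟨rfl, rfl, fun s hs t ht => ?_⟩
    simp only [dist_self, Set.Icc_self, Set.mem_singleton_iff] at hs ht
    simp [hs, ht]
  obtain ⟨q, -, hq⟩ := hs x x x _ _ _ hg hg hg x ⟨0, by simp, rfl⟩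
  exact dist_nonneg.trans hq

/-- A side of a slim triangle contains a point which is nearly on both other sides. -/
theorem SlimTriangles.exists_center {δ : ℝ} (hX : IsGeodesicSpace X) (hs : SlimTriangles δ X)
    {x z : X} {α : ℝ → X} (hα : IsGeodesic x z α) (y : X) :
    ∃ t ∈ Set.Icc 0 (dist x z), t + dist (α t) y ≤ dist x y + (2 * δ + 2) ∧
      (dist x z - t) + dist (α t) y ≤ dist y z + (2 * δ + 2) := by
  obtain ⟨β, hβ⟩ := hX z y
  obtain ⟨γ, hγ⟩ := hX x y
  have hδ := hs.nonneg x
  have key : ∀ t ∈ Set.Icc 0 (dist x z), t + dist (α t) y ≤ dist x y + 2 * δ ∨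
      (dist x z - t) + dist (α t) y ≤ dist y z + 2 * δ := by
    intro t ht
    obtain ⟨q, hq, hd⟩ := hs x z y α β γ hα hβ hγ (α t) ⟨t, ht, rfl⟩
    have h3 := dist_triangle (α t) q y
    rcases hq with ⟨r, hr, rfl⟩ | ⟨r, hr, rfl⟩
    · right
      have h1 := hβ.dist_left hr
      have h2 := hβ.dist_right hr
      have h4 := dist_triangle (α t) (β r) z
      rw [hα.dist_right ht] at h4
      rw [dist_comm z] at h1 h2
      linarith
    · left
      have h1 := hγ.dist_left hr
      have h2 := hγ.dist_right hr
      have h4 := dist_triangle x (γ r) (α t)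
      rw [hα.dist_left ht, dist_comm (γ r)] at h4
      linarith
  set A : Set ℝ := {t | t ∈ Set.Icc 0 (dist x z) ∧ t + dist (α t) y ≤ dist x y + 2 * δ} with hA
  have h0 : (0 : ℝ) ∈ A := ⟨⟨le_rfl, dist_nonneg⟩, by rw [hα.1]; linarith⟩
  have hbdd : BddAbove A := ⟨dist x z, fun t ht => ht.1.2⟩
  -- A near-supremum suffices: `t + 1` is outside `A`, so it satisfies the other alternative, and
  -- moving back by 1 costs the extra 2.
  obtain ⟨t, ht, hlt⟩ := exists_lt_of_lt_csSup ⟨0, h0⟩ (sub_one_lt (sSup A))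
  refine ⟨t, ht.1, by linarith [ht.2], ?_⟩
  by_cases hc : t + 1 ≤ dist x z
  · have ht' : t + 1 ∈ Set.Icc 0 (dist x z) := ⟨by linarith [ht.1.1], hc⟩
    rcases key _ ht' with h | h
    · have := le_csSup hbdd (show t + 1 ∈ A from ⟨ht', h⟩)
      linarith
    · have h1 := hα.2.2 t ht.1 _ ht'
      have h2 := dist_triangle (α t) (α (t + 1)) y
      have h3 : |t - (t + 1)| = 1 := by norm_num
      linarith
  · have h1 := hα.dist_right ht.1
    have h2 := dist_triangle (α t) z y
    rw [dist_comm z y] at h2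
    linarith

/-- Go from `y` to `w` through their centres on a geodesic from `x` to `z`; the order of the two
centres decides which term of the maximum is used. -/
theorem SlimTriangles.fourPoint {δ : ℝ} (hX : IsGeodesicSpace X) (hs : SlimTriangles δ X) :
    FourPoint (4 * δ + 4) X := by
  intro x y z w
  obtain ⟨α, hα⟩ := hX x z
  obtain ⟨s, hs1, h1, h2⟩ := hs.exists_center hX hα y
  obtain ⟨t, ht1, h3, h4⟩ := hs.exists_center hX hα w
  have h5 := dist_triangle4 y (α s) (α t) w
  rw [hα.2.2 s hs1 t ht1, dist_comm y (α s)] at h5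
  rw [dist_comm w z] at h4
  rcases le_total s t with h | h
  · rw [abs_of_nonpos (by linarith)] at h5
    have := le_max_right (dist x y + dist z w) (dist x w + dist y z)
    linarith
  · rw [abs_of_nonneg (by linarith)] at h5
    have := le_max_left (dist x y + dist z w) (dist x w + dist y z)
    linarith

/-- The four-point condition as an inequality between (doubled) Gromov products. -/
theorem FourPoint.product {δ : ℝ} (hF : FourPoint δ X) {m x y z : X} {r : ℝ}
    (h : dist x y + r ≤ dist x m + dist y m) (h' : dist y z + r ≤ dist y m + dist z m) :
    dist x z + (r - δ) ≤ dist x m + dist z m := by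
  have := hF x y z m
  rcases max_choice (dist x y + dist z m) (dist x m + dist y z) with h2 | h2 <;>
    rw [h2] at this <;> linarith

/-- Splitting the chain dyadically makes the loss logarithmic in its length: each level of halving
costs one `δ`. -/
theorem FourPoint.product_chain {δ : ℝ} (hδ : 0 ≤ δ) (hF : FourPoint δ X) {m : X} {r : ℝ}
    (p : ℕ → X) (k : ℕ) : ∀ i n : ℕ, 1 ≤ n → n ≤ 2 ^ k →
    (∀ j, i ≤ j → j < i + n → dist (p j) (p (j + 1)) + r ≤ dist (p j) m + dist (p (j + 1)) m) →
    dist (p i) (p (i + n)) + (r - k * δ) ≤ dist (p i) m + dist (p (i + n)) m := by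
  induction k with
  | zero =>
    intro i n h1 h2 h
    obtain rfl : n = 1 := le_antisymm (by simpa using h2) h1
    simpa using h i le_rfl (by omega)
  | succ k ih =>
    intro i n h1 h2 h
    rw [pow_succ] at h2
    push_cast
    by_cases hn : n ≤ 2 ^ k
    · have := ih i n h1 hn h
      linarith
    · obtain ⟨n', rfl⟩ := Nat.exists_eq_add_of_lt (not_le.1 hn)
      have e1 := ih i (2 ^ k) Nat.one_le_two_pow le_rfl (fun j hj hj' => h j hj (by omega))
      have e2 := ih (i + 2 ^ k) (n' + 1) (by omega) (by omega)
        (fun j hj hj' => h j (by omega) (by omega))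
      have := hF.product e1 e2
      rw [← add_assoc, ← add_assoc]
      rw [← add_assoc] at this
      linarith

/-- A finite sequence that is a quasi-isometric embedding of `{0, …, n}`. -/
def IsQuasiGeodesicSeq (c : ℝ) (n : ℕ) (q : ℕ → X) : Prop :=
  ∀ i ≤ n, ∀ j ≤ n, |(i : ℝ) - j| ≤ c * dist (q i) (q j) + c ∧
    dist (q i) (q j) ≤ c * |(i : ℝ) - j| + c

/-- Consecutive points are at most `2 * c` apart and at least `D` from `m`, so every link has
doubled product at least `2 * D - 2 * c`. -/
theorem IsQuasiGeodesicSeq.product {δ c : ℝ} (hδ : 0 ≤ δ) (hc : 0 ≤ c) (hF : FourPoint δ X)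
    {n : ℕ} {q : ℕ → X} (hq : IsQuasiGeodesicSeq c n q) {m : X} {D : ℝ}
    (hD : ∀ i ≤ n, D ≤ dist (q i) m) {i l k : ℕ} (hil : i + l ≤ n) (hlk : l ≤ 2 ^ k) :
    dist (q i) (q (i + l)) + (2 * D - 2 * c - k * δ) ≤ dist (q i) m + dist (q (i + l)) m := by
  rcases Nat.eq_zero_or_pos l with rfl | hl
  · have := hD i (by omega)
    have h2 : 0 ≤ k * δ := by positivity
    simp only [add_zero, dist_self]
    linarith
  · refine hF.product_chain hδ q k i l hl hlk fun j hj hj' => ?_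
    have h1 := hD j (by omega)
    have h2 := hD (j + 1) (by omega)
    have h3 := (hq j (by omega) (j + 1) (by omega)).2
    have h4 : |(j : ℝ) - (j + 1 : ℕ)| = 1 := by push_cast; norm_num
    rw [h4] at h3
    linarith

theorem exists_forall_two_pow_le_imp_lt (A B : ℝ) :
    ∃ K : ℕ, ∀ k : ℕ, (2 : ℝ) ^ k ≤ A + B * k → k < K := by
  have h1 := tendsto_pow_const_div_const_pow_of_one_lt 1 (one_lt_two (α := ℝ))
  have h0 := tendsto_pow_const_div_const_pow_of_one_lt 0 (one_lt_two (α := ℝ))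
  have h := (h0.const_mul A).add (h1.const_mul B)
  simp only [mul_zero, add_zero] at h
  obtain ⟨K, hK⟩ := Filter.eventually_atTop.1 (h.eventually_lt_const one_pos)
  refine ⟨K, fun k hk => ?_⟩
  by_contra! hc
  have h2 := hK k hc
  have h3 : (0 : ℝ) < 2 ^ k := by positivity
  rw [pow_zero, pow_one, ← mul_div_assoc, ← mul_div_assoc, ← add_div, div_lt_one h3] at h2
  linarith

/-- Morse lemma: a geodesic stays close to any quasi-geodesic sequence with the same endpoints. -/
theorem FourPoint.geodesic_near_seq {δ c : ℝ} (hδ : 0 ≤ δ) (hc : 0 ≤ c) (hF : FourPoint δ X) :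
    ∃ C : ℝ, 0 ≤ C ∧ ∀ (n : ℕ) (q : ℕ → X) (σ : ℝ → X), IsQuasiGeodesicSeq c n q →
      IsGeodesic (q 0) (q n) σ → ∀ t ∈ Set.Icc 0 (dist (q 0) (q n)),
        ∃ i ≤ n, dist (σ t) (q i) ≤ C := by
  -- These constants come from combining `2 ^ k ≤ 1 + 2 * l`, `l ≤ c * (6 * D) + c` and `D ≤ c + 2 *
  -- δ + k * δ`, proved below.
  obtain ⟨K, hK⟩ := exists_forall_two_pow_le_imp_lt
    (1 + 2 * (c * (6 * (c + 2 * δ)) + c)) (2 * (c * (6 * δ)))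
  refine ⟨c + (K + 2) * δ, by positivity, fun n q σ hq hσ t ht => ?_⟩
  set P : Set X := q '' Set.Iic n with hP
  have hPc : IsCompact P := ((Set.finite_Iic n).image q).isCompact
  have hPn : P.Nonempty := ⟨q 0, 0, by simp, rfl⟩
  -- Work at the point of the geodesic furthest from the sequence; its distance `D` then bounds all
  -- the others.
  obtain ⟨t₀, ht₀, hmax⟩ := isCompact_Icc.exists_isMaxOn ⟨t, ht⟩
    ((Metric.continuous_infDist_pt P).comp_continuousOn hσ.continuousOn)
  have near : ∀ s ∈ Set.Icc 0 (dist (q 0) (q n)), ∃ i ≤ n,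
      dist (σ s) (q i) ≤ Metric.infDist (σ t₀) P := by
    intro s hs
    obtain ⟨_, ⟨i, hi, rfl⟩, h⟩ := hPc.exists_infDist_eq_dist hPn (σ s)
    exact ⟨i, hi, h ▸ hmax hs⟩
  set D := Metric.infDist (σ t₀) P with hD
  set m := σ t₀ with hm
  have hD0 : 0 ≤ D := Metric.infDist_nonneg
  have far : ∀ i ≤ n, D ≤ dist (q i) m := fun i hi => by
    rw [dist_comm]; exact Metric.infDist_le_dist_of_mem ⟨i, hi, rfl⟩
  suffices hfin : D ≤ c + (K + 2) * δ by
    obtain ⟨i, hi, h⟩ := near t ht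
    exact ⟨i, hi, h.trans hfin⟩
  -- At distance `2 * D` from `m`, the jump from `u` to a nearby `q i` still has doubled product at
  -- least `2 * D` at `m`. If the geodesic ends sooner, its endpoint is itself in the sequence.
  have left : ∃ u, ∃ i ≤ n, dist u m ≤ 2 * D ∧ dist u (q i) ≤ D ∧
      dist u (q i) + 2 * D ≤ dist u m + dist (q i) m ∧
      ∃ s ∈ Set.Icc 0 t₀, u = σ s := by
    by_cases h : 2 * D ≤ t₀
    · have hs : t₀ - 2 * D ∈ Set.Icc 0 (dist (q 0) (q n)) :=
        ⟨by linarith, by linarith [ht₀.2]⟩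
      obtain ⟨i, hi, h1⟩ := near _ hs
      have h2 := hσ.2.2 _ hs _ ht₀
      rw [show t₀ - 2 * D - t₀ = -(2 * D) by ring, abs_neg, abs_of_nonneg (by linarith)] at h2
      refine ⟨_, i, hi, h2.le, h1, ?_, _, ⟨hs.1, by linarith⟩, rfl⟩
      have := far i hi
      linarith
    · have h1 := hσ.dist_left ht₀
      have h2 := far 0 (by omega)
      refine ⟨q 0, 0, by omega, by linarith, by simpa using hD0, ?_, 0, ⟨le_rfl, ht₀.1⟩,
        hσ.1.symm⟩
      rw [dist_self]; linarith
  have right : ∃ v, ∃ i ≤ n, dist v m ≤ 2 * D ∧ dist v (q i) ≤ D ∧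
      dist v (q i) + 2 * D ≤ dist v m + dist (q i) m ∧
      ∃ s ∈ Set.Icc t₀ (dist (q 0) (q n)), v = σ s := by
    by_cases h : t₀ + 2 * D ≤ dist (q 0) (q n)
    · have hs : t₀ + 2 * D ∈ Set.Icc 0 (dist (q 0) (q n)) := ⟨by linarith [ht₀.1], h⟩
      obtain ⟨i, hi, h1⟩ := near _ hs
      have h2 := hσ.2.2 _ hs _ ht₀
      rw [add_sub_cancel_left, abs_of_nonneg (by linarith)] at h2
      refine ⟨_, i, hi, h2.le, h1, ?_, _, ⟨by linarith, h⟩, rfl⟩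
      have := far i hi
      linarith
    · have h1 := hσ.dist_right ht₀
      have h2 := far n le_rfl
      rw [dist_comm] at h1
      refine ⟨q n, n, le_rfl, by linarith, by simpa using hD0, ?_, _, ⟨ht₀.2, le_rfl⟩,
        hσ.2.1.symm⟩
      rw [dist_self]; linarith
  obtain ⟨u, i, hi, hu1, hu2, hu3, s, hs, hus⟩ := left
  obtain ⟨v, j, hj, hv1, hv2, hv3, s', hs', hvs⟩ := right
  have huv : dist u v = dist u m + dist v m := by
    have a1 : s ∈ Set.Icc 0 (dist (q 0) (q n)) := ⟨hs.1, hs.2.trans ht₀.2⟩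
    have a2 : s' ∈ Set.Icc 0 (dist (q 0) (q n)) := ⟨ht₀.1.trans hs'.1, hs'.2⟩
    rw [hus, hvs, hm, hσ.2.2 _ a1 _ a2, hσ.2.2 _ a1 _ ht₀, hσ.2.2 _ a2 _ ht₀,
      abs_of_nonpos (by linarith [hs.2, hs'.1]), abs_of_nonpos (by linarith [hs.2]),
      abs_of_nonneg (by linarith [hs'.1])]
    ring
  set l : ℕ := max i j - min i j with hl
  set k := Nat.clog 2 l with hk
  have hlk : l ≤ 2 ^ k := Nat.le_pow_clog one_lt_two l
  have hmid : dist (q i) (q j) + (2 * D - 2 * c - k * δ) ≤ dist (q i) m + dist (q j) m := by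
    rcases le_total i j with h | h
    · have := hq.product hδ hc hF far (i := i) (l := l) (k := k) (by omega) hlk
      rwa [show i + l = j by omega] at this
    · have := hq.product hδ hc hF far (i := j) (l := l) (k := k) (by omega) hlk
      rw [show j + l = i by omega, dist_comm] at this
      linarith
  have hkδ : 0 ≤ k * δ := by positivity
  -- The product of `u` and `v` at `m` is zero, since `m` lies between them, while the chain `u`, `q
  -- i`, `q j`, `v` bounds it below.
  have hb : 2 * D ≤ 2 * c + k * δ + 2 * δ := by
    have e1 := hF.product (m := m) (x := u) (y := q i) (z := q j) (r := 2 * D - 2 * c - k * δ)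
      (by linarith) hmid
    have e2 := hF.product (m := m) (x := u) (y := q j) (z := v)
      (r := 2 * D - 2 * c - k * δ - δ) e1 (by rw [dist_comm (q j)]; linarith)
    linarith
  have hlD : (l : ℝ) ≤ c * (6 * D) + c := by
    have h1 := (hq i hi j hj).1
    have h2 : (l : ℝ) = |(i : ℝ) - j| := by
      rcases le_total i j with h | h
      · rw [hl, max_eq_right h, min_eq_left h, Nat.cast_sub h, abs_sub_comm,
          abs_of_nonneg (sub_nonneg.2 (Nat.cast_le.2 h))]
      · rw [hl, max_eq_left h, min_eq_right h, Nat.cast_sub h,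
          abs_of_nonneg (sub_nonneg.2 (Nat.cast_le.2 h))]
    have h3 : dist (q i) (q j) ≤ 6 * D := by
      have := dist_triangle4 (q i) u v (q j)
      rw [dist_comm (q i) u] at this
      linarith
    rw [h2]
    exact h1.trans (by gcongr)
  have hpow : (2 : ℝ) ^ k ≤ 1 + 2 * l := by
    rcases Nat.lt_or_ge 1 l with h | h
    · have := Nat.pow_pred_clog_lt_self one_lt_two h
      have hk1 : k - 1 + 1 = k := Nat.sub_add_cancel (Nat.clog_pos one_lt_two h)
      rw [← hk1, pow_succ]
      have h5 : ((2 ^ (k - 1) : ℕ) : ℝ) < l := by exact_mod_cast this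
      push_cast at h5
      linarith
    · rw [hk, Nat.clog_of_right_le_one h]
      have : (0 : ℝ) ≤ l := by positivity
      simp
  have hDk : D ≤ c + 2 * δ + k * δ := by linarith
  have hkK : k < K := hK k <| by
    have : c * (6 * D) ≤ c * (6 * (c + 2 * δ + k * δ)) := by gcongr
    linarith
  have : (k : ℝ) * δ ≤ K * δ := by gcongr
  linarith

theorem exists_near_of_bounded_steps {J k : ℕ} (f : ℕ → ℕ) (N : ℕ)
    (hf : ∀ i < N, f (i + 1) ≤ f i + J) (h0 : f 0 ≤ k) (hN : k ≤ f N) :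
    ∃ i ≤ N, f i ≤ k + J ∧ k ≤ f i := by
  classical
  have hex : ∃ i, k ≤ f i := ⟨N, hN⟩
  have hle : Nat.find hex ≤ N := Nat.find_le hN
  refine ⟨Nat.find hex, hle, ?_, Nat.find_spec hex⟩
  rcases h : Nat.find hex with _ | i
  · omega
  · have h1 := Nat.find_min hex (m := i) (by omega)
    have := hf i (by omega)
    omega

/-- Morse lemma: a quasi-geodesic sequence stays close to any geodesic with the same endpoints. -/
theorem FourPoint.seq_near_geodesic {δ c : ℝ} (hδ : 0 ≤ δ) (hc : 0 ≤ c) (hF : FourPoint δ X) :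
    ∃ C : ℝ, 0 ≤ C ∧ ∀ (n : ℕ) (q : ℕ → X) (σ : ℝ → X), IsQuasiGeodesicSeq c n q →
      IsGeodesic (q 0) (q n) σ → ∀ i ≤ n,
        ∃ t ∈ Set.Icc 0 (dist (q 0) (q n)), dist (q i) (σ t) ≤ C := by
  obtain ⟨C, hC, h⟩ := hF.geodesic_near_seq hδ hc
  set J : ℕ := ⌈c * (2 * C + 1) + c⌉₊ with hJ
  refine ⟨c * J + c + C, by positivity, fun n q σ hq hσ i hi => ?_⟩
  set ℓ := dist (q 0) (q n) with hℓ
  set N := ⌈ℓ⌉₊ with hN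
  have hs : ∀ k : ℕ, min (k : ℝ) ℓ ∈ Set.Icc 0 ℓ := fun k =>
    ⟨le_min (Nat.cast_nonneg k) dist_nonneg, min_le_right _ _⟩
  -- Unit steps along the geodesic get indices of nearby sequence points, running from 0 to `n` with
  -- bounded increases, so they nearly hit `i`. If `ℓ = 0`, both end conditions would fall on `k =
  -- 0`; hence `k ≠ 0` here and the last step `N + 1` below.
  have hex : ∀ k : ℕ, ∃ j ≤ n, dist (σ (min (k : ℝ) ℓ)) (q j) ≤ C ∧ (k = 0 → j = 0) ∧
      (ℓ ≤ k → k ≠ 0 → j = n) := by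
    intro k
    by_cases h0 : k = 0
    · refine ⟨0, by omega, ?_, fun _ => rfl, fun _ h => absurd h0 h⟩
      rw [h0, Nat.cast_zero, min_eq_left dist_nonneg, hσ.1, dist_self]
      exact hC
    · by_cases h1 : ℓ ≤ k
      · refine ⟨n, le_rfl, ?_, fun h => absurd h h0, fun _ _ => rfl⟩
        rw [min_eq_right h1, hσ.2.1, dist_self]
        exact hC
      · obtain ⟨j, hj, hd⟩ := h n q σ hq hσ _ (hs k)
        exact ⟨j, hj, hd, fun h => absurd h h0, fun h => absurd h h1⟩
  choose f hf1 hf2 hf3 hf4 using hex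
  have hstep : ∀ k < N + 1, f (k + 1) ≤ f k + J := by
    intro k _
    have h1 := (hq _ (hf1 (k + 1)) _ (hf1 k)).1
    have h2 : dist (σ (min ((k + 1 : ℕ) : ℝ) ℓ)) (σ (min (k : ℝ) ℓ)) ≤ 1 := by
      rw [hσ.2.2 _ (hs _) _ (hs _)]
      refine (abs_min_sub_min_le_max _ _ _ _).trans ?_
      simp
    have h3 := dist_triangle4 (q (f (k + 1))) (σ (min ((k + 1 : ℕ) : ℝ) ℓ))
      (σ (min (k : ℝ) ℓ)) (q (f k))
    rw [dist_comm (q (f (k + 1))) (σ _)] at h3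
    have h4 : dist (q (f (k + 1))) (q (f k)) ≤ 2 * C + 1 := by linarith [hf2 k, hf2 (k + 1)]
    have h5 : (f (k + 1) : ℝ) - f k ≤ J :=
      calc (f (k + 1) : ℝ) - f k ≤ c * dist (q (f (k + 1))) (q (f k)) + c :=
            (le_abs_self _).trans h1
        _ ≤ c * (2 * C + 1) + c := by gcongr
        _ ≤ J := Nat.le_ceil _
    have : (f (k + 1) : ℝ) ≤ (f k + J : ℕ) := by push_cast; linarith
    exact_mod_cast this
  obtain ⟨k, -, hk1, hk2⟩ := exists_near_of_bounded_steps f (N + 1) hstep (k := i)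
    (by rw [hf3 0 rfl]; omega)
    (by rw [hf4 (N + 1) (by push_cast; linarith [Nat.le_ceil ℓ]) (by omega)]; exact hi)
  refine ⟨_, hs k, ?_⟩
  have h1 := (hq i hi _ (hf1 k)).2
  have h2 : |(i : ℝ) - f k| ≤ J := by
    rw [abs_sub_comm, abs_of_nonneg (sub_nonneg.2 (Nat.cast_le.2 hk2))]
    have : (f k : ℝ) ≤ (i + J : ℕ) := Nat.cast_le.2 hk1
    push_cast at this; linarith
  have h3 := dist_triangle (q i) (q (f k)) (σ (min (k : ℝ) ℓ))
  rw [dist_comm (q (f k))] at h3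
  have h4 : c * |(i : ℝ) - f k| ≤ c * J := by gcongr
  linarith [hf2 k]

/-- Quasi-geodesic sequences with the same endpoints are close to each other. -/
theorem FourPoint.seq_near_seq {δ c : ℝ} (hX : IsGeodesicSpace X) (hδ : 0 ≤ δ) (hc : 0 ≤ c)
    (hF : FourPoint δ X) :
    ∃ C : ℝ, 0 ≤ C ∧ ∀ (n n' : ℕ) (q q' : ℕ → X), IsQuasiGeodesicSeq c n q →
      IsQuasiGeodesicSeq c n' q' → q 0 = q' 0 → q n = q' n' → ∀ i ≤ n,
        ∃ j ≤ n', dist (q i) (q' j) ≤ C := by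
  obtain ⟨C, hC, h⟩ := hF.geodesic_near_seq hδ hc
  obtain ⟨C', hC', h'⟩ := hF.seq_near_geodesic hδ hc
  refine ⟨C' + C, by positivity, fun n n' q q' hq hq' h0 hn i hi => ?_⟩
  obtain ⟨σ, hσ⟩ := hX (q 0) (q n)
  obtain ⟨t, ht, hd⟩ := h' n q σ hq hσ i hi
  obtain ⟨j, hj, hd'⟩ := h n' q' σ hq' (by rwa [← h0, ← hn]) t (by rwa [← h0, ← hn])
  exact ⟨j, hj, (dist_triangle _ (σ t) _).trans (add_le_add hd hd')⟩

/-- Nearly nearest points `p`, `p'` of a quasiconvex set to `a`, `a'` lie almost on every geodesic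
from `a` to `a'`, unless they are close to each other. -/
theorem FourPoint.projection {δ Q : ℝ} (hX : IsGeodesicSpace X) (hδ : 0 ≤ δ)
    (hF : FourPoint δ X) {Y : Set X}
    (hY : ∀ y ∈ Y, ∀ y' ∈ Y, ∀ σ, IsGeodesic y y' σ → ∀ t ∈ Set.Icc 0 (dist y y'),
      ∃ z ∈ Y, dist (σ t) z ≤ Q)
    {a a' p p' : X} (hp : p ∈ Y) (hp' : p' ∈ Y) (ha : ∀ y ∈ Y, dist a p ≤ dist a y + 1)
    (ha' : ∀ y ∈ Y, dist a' p' ≤ dist a' y + 1) (hpp : 2 * (δ + Q + 1) + δ < dist p p') :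
    dist a p + dist p p' + dist p' a' ≤ dist a a' + (4 * (δ + Q + 1) + δ) := by
  have key : ∀ {a p y : X}, p ∈ Y → y ∈ Y → (∀ y ∈ Y, dist a p ≤ dist a y + 1) →
      dist a p + dist p y ≤ dist a y + 2 * (δ + Q + 1) := by
    intro a p y hp hy ha
    obtain ⟨σ, hσ⟩ := hX p y
    -- The Gromov product of `a` and `y` at `p`. The point `σ t` is about `t` closer to `a` than `p`
    -- is, so near-minimality of `p` forces `t ≤ δ + Q + 1`.
    set t := (dist a p + dist p y - dist a y) / 2 with ht
    have htm : t ∈ Set.Icc 0 (dist p y) := by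
      have h1 := dist_triangle a p y
      have h2 := dist_triangle a y p
      rw [dist_comm y p] at h2
      constructor <;> linarith
    obtain ⟨z, hz, hd⟩ := hY p hp y hy σ hσ t htm
    have h1 := hσ.dist_left htm
    have h2 := hσ.dist_right htm
    have h3 := hF a p (σ t) y
    have h4 := dist_triangle a (σ t) z
    have h5 := ha z hz
    have h6 : max (dist a p + dist (σ t) y) (dist a y + dist p (σ t)) ≤
      dist a p + dist p y - t := max_le (by linarith) (by linarith)
    linarith
  have e1 := key hp hp' ha
  have e2 := key hp' hp ha'
  rw [dist_comm p' p] at e2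
  have e3 := hF a a' p' p
  rw [dist_comm p' p] at e3
  rw [dist_comm p' a']
  -- The second alternative would bound `dist p p'` and contradict `hpp`.
  rcases max_choice (dist a a' + dist p p') (dist a p + dist a' p') with h | h <;>
    rw [h] at e3 <;> linarith

/-- Points lying almost on a geodesic from `x` to `z`, at almost the same distance from `x`, are
close to each other. -/
theorem FourPoint.dist_le_of_between {δ C : ℝ} (hF : FourPoint δ X) {x z y y' : X}
    (h : dist x y + dist y z ≤ dist x z + C) (h' : dist x y' + dist y' z ≤ dist x z + C)
    (hd : |dist x y - dist x y'| ≤ 1) : dist y y' ≤ C + 1 + δ := by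
  have e := hF x y z y'
  obtain ⟨h1, h2⟩ := abs_le.1 hd
  rw [dist_comm z y'] at e
  rcases max_choice (dist x y + dist y' z) (dist x y' + dist y z) with h | h <;>
    rw [h] at e <;> linarith

end Hyperbolic

end AQI

namespace AQI

/-! ### Word metrics: invariance, finite balls, geodesic sequences. -/

section WordMetric

variable {G : Type*} [Group G] {S : Set G}

/-- The word distance with respect to `S`. -/
noncomputable def wordDist (S : Set G) (g h : G) : ℝ := (SimpleGraph.mulCayley S).dist g h

theorem wordDist_nonneg (g h : G) : 0 ≤ wordDist S g h := Nat.cast_nonneg _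

@[simp]
theorem wordDist_self (g : G) : wordDist S g g = 0 := by simp [wordDist]

theorem wordDist_comm (g h : G) : wordDist S g h = wordDist S h g := by
  rw [wordDist, SimpleGraph.dist_comm, wordDist]

theorem wordDist_triangle (hS : Subgroup.closure S = ⊤) (a b c : G) :
    wordDist S a c ≤ wordDist S a b + wordDist S b c := by
  unfold wordDist
  exact_mod_cast (connected_mulCayley hS).dist_triangle

theorem wordDist_mul_left (hS : Subgroup.closure S = ⊤) (g a b : G) :
    wordDist S (g * a) (g * b) = wordDist S a b := by
  have key : ∀ g a b : G, (SimpleGraph.mulCayley S).dist (g * a) (g * b) ≤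
      (SimpleGraph.mulCayley S).dist a b := by
    intro g a b
    obtain ⟨p, hp⟩ := (connected_mulCayley hS).exists_walk_length_eq_dist a b
    let f : SimpleGraph.mulCayley S →g SimpleGraph.mulCayley S :=
      ⟨fun x => g * x, fun h => SimpleGraph.mulCayley_adj_mul_iff_right.2 h⟩
    rw [← hp, ← p.length_map f]
    exact SimpleGraph.dist_le (p.map f)
  refine le_antisymm (Nat.cast_le.2 (key g a b)) (Nat.cast_le.2 ?_)
  simpa using key g⁻¹ (g * a) (g * b)

theorem dist_le_mul_wordDist {Z : Type*} [PseudoMetricSpace Z] (hS : Subgroup.closure S = ⊤)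
    {F : G → Z} {K : ℝ} (hF : ∀ g, ∀ s ∈ S, dist (F g) (F (g * s)) ≤ K) (g h : G) :
    dist (F g) (F h) ≤ K * wordDist S g h := by
  obtain ⟨p, hp⟩ := (connected_mulCayley hS).exists_walk_length_eq_dist g h
  rw [wordDist, ← hp]
  clear hp
  induction p with
  | nil => simp
  | @cons u v w huv p ih =>
    have h1 : dist (F u) (F v) ≤ K := by
      rcases ((SimpleGraph.mulCayley_adj S u v).1 huv).2 with h | h
      · simpa using hF u _ h
      · rw [dist_comm]; simpa using hF v _ h
    have h2 := dist_triangle (F u) (F v) (F w)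
    rw [SimpleGraph.Walk.length_cons]
    push_cast
    linarith

/-- A left-invariant map from a group to a metric space is Lipschitz for the word metric. -/
theorem exists_dist_le_mul_wordDist {Z : Type*} [PseudoMetricSpace Z]
    (hS : Subgroup.closure S = ⊤) (hfin : S.Finite) (F : G → Z)
    (hF : ∀ g a b, dist (F (g * a)) (F (g * b)) = dist (F a) (F b)) :
    ∃ K : ℝ, 0 ≤ K ∧ ∀ g h, dist (F g) (F h) ≤ K * wordDist S g h := by
  obtain ⟨K, hK⟩ := (hfin.image fun s => dist (F 1) (F s)).bddAbove
  refine ⟨max K 0, le_max_right _ _, dist_le_mul_wordDist hS fun g s hs => ?_⟩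
  have := hF g 1 s
  rw [mul_one] at this
  rw [this]
  exact (hK ⟨s, hs, rfl⟩).trans (le_max_left _ _)

theorem finite_wordDist_le (hS : Subgroup.closure S = ⊤) (hfin : S.Finite) (r : ℝ) :
    {g : G | wordDist S 1 g ≤ r}.Finite := by
  have key : ∀ n : ℕ, {g : G | ∃ p : (SimpleGraph.mulCayley S).Walk g 1, p.length = n}.Finite := by
    intro n
    induction n with
    | zero =>
      refine (Set.finite_singleton (1 : G)).subset ?_
      rintro g ⟨p, hp⟩
      exact SimpleGraph.Walk.eq_of_length_eq_zero hp
    | succ n ih =>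
      refine (Set.Finite.union (Set.Finite.image2 (fun a s => a * s⁻¹) ih hfin)
        (Set.Finite.image2 (fun a s => a * s) ih hfin)).subset ?_
      rintro g ⟨p, hp⟩
      cases p with
      | nil => simp at hp
      | @cons _ v _ h p =>
        have hv : ∃ p : (SimpleGraph.mulCayley S).Walk v 1, p.length = n := ⟨p, by simpa using hp⟩
        rcases ((SimpleGraph.mulCayley_adj S g v).1 h).2 with h | h
        · exact Or.inl ⟨v, hv, _, h, by simp⟩
        · exact Or.inr ⟨v, hv, _, h, by simp⟩
  refine (Set.Finite.biUnion (Set.finite_Iic ⌊r⌋₊) fun n _ => key n).subset fun g hg => ?_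
  obtain ⟨p, hp⟩ := (connected_mulCayley hS).exists_walk_length_eq_dist g 1
  refine Set.mem_biUnion (x := p.length) ?_ ⟨p, rfl⟩
  rw [hp, SimpleGraph.dist_comm]
  exact Nat.le_floor hg

/-- Any two elements are joined by a geodesic sequence. -/
theorem exists_geodesic_seq (hS : Subgroup.closure S = ⊤) (g h : G) :
    ∃ (n : ℕ) (q : ℕ → G), q 0 = g ∧ q n = h ∧
      ∀ i ≤ n, ∀ j ≤ n, wordDist S (q i) (q j) = |(i : ℝ) - j| := by
  obtain ⟨p, hp⟩ := (connected_mulCayley hS).exists_walk_length_eq_dist g h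
  have hstep : ∀ i k, wordDist S (p.getVert i) (p.getVert (i + k)) ≤ k := by
    intro i k
    induction k with
    | zero => simp
    | succ k ih =>
      have h1 : wordDist S (p.getVert (i + k)) (p.getVert (i + k + 1)) ≤ 1 := by
        by_cases hk : i + k < p.length
        · have := SimpleGraph.dist_le (p.adj_getVert_succ hk).toWalk
          simpa [wordDist] using this
        · rw [p.getVert_of_length_le (by omega), p.getVert_of_length_le (by omega)]
          simp
      have h2 := wordDist_triangle hS (p.getVert i) (p.getVert (i + k)) (p.getVert (i + k + 1))
      push_cast
      rw [← add_assoc]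
      linarith
  have key : ∀ i k, i + k ≤ p.length → wordDist S (p.getVert i) (p.getVert (i + k)) = k := by
    intro i k hk
    refine le_antisymm (hstep i k) ?_
    have h1 := hstep 0 i
    have h2 := hstep (i + k) (p.length - (i + k))
    rw [zero_add] at h1
    rw [Nat.add_sub_cancel' hk, Nat.cast_sub hk] at h2
    have h3 := wordDist_triangle hS (p.getVert 0) (p.getVert i) (p.getVert p.length)
    have h4 := wordDist_triangle hS (p.getVert i) (p.getVert (i + k)) (p.getVert p.length)
    have h5 : wordDist S (p.getVert 0) (p.getVert p.length) = p.length := by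
      rw [p.getVert_zero, p.getVert_length, hp, wordDist]
    push_cast at h2
    linarith
  refine ⟨p.length, p.getVert, p.getVert_zero, p.getVert_length, fun i hi j hj => ?_⟩
  rcases le_total i j with h | h
  · obtain ⟨k, rfl⟩ := Nat.exists_eq_add_of_le h
    rw [key i k hj]; push_cast
    rw [sub_add_cancel_left, abs_neg, Nat.abs_cast]
  · obtain ⟨k, rfl⟩ := Nat.exists_eq_add_of_le h
    rw [wordDist_comm, key j k hi]; push_cast
    rw [add_sub_cancel_left, Nat.abs_cast]

end WordMetric

end AQI

namespace AQI

/-! ### Contracting projections and the quasi-geodesics they control. -/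

section Contraction

variable {M X : Type*} [MetricSpace X]

/-- `y` is, up to an error of `1`, a point of `Y` whose image is nearest to the image of `g`. -/
def IsNearlyNearest (F : M → X) (Y : Set M) (g y : M) : Prop :=
  y ∈ Y ∧ ∀ z ∈ Y, dist (F g) (F y) ≤ dist (F g) (F z) + 1

theorem exists_isNearlyNearest (F : M → X) {Y : Set M} (hY : Y.Nonempty) (g : M) :
    ∃ y, IsNearlyNearest F Y g y := by
  obtain ⟨_, ⟨y, hy, rfl⟩, hlt⟩ := exists_lt_of_csInf_lt (hY.image fun z => dist (F g) (F z))
    (lt_add_one (sInf ((fun z => dist (F g) (F z)) '' Y)))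
  have hbdd : BddBelow ((fun z => dist (F g) (F z)) '' Y) :=
    ⟨0, by rintro _ ⟨z, -, rfl⟩; exact dist_nonneg⟩
  refine ⟨y, hy, fun z hz => hlt.le.trans ?_⟩
  have : sInf ((fun z => dist (F g) (F z)) '' Y) ≤ dist (F g) (F z) := csInf_le hbdd ⟨z, hz, rfl⟩
  linarith

variable [MetricSpace M]

/-- The projection to `Y`, measured after applying `F`, contracts every bounded set far from `Y`
to a set of diameter at most `R`. -/
def IsContracting (F : M → X) (Y : Set M) (R : ℝ) : Prop :=
  ∀ L : ℝ, ∃ D : ℝ, ∀ g g' y y' : M, IsNearlyNearest F Y g y → IsNearlyNearest F Y g' y' →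
    dist g g' ≤ L → (∀ z ∈ Y, D < dist g z) → dist (F y) (F y') ≤ R

theorem exists_maximal_gap {P : ℕ → Prop} {n k : ℕ} (hk : k ≤ n) (h0 : P 0) (hn : P n)
    (hPk : ¬ P k) : ∃ i j, i < k ∧ k < j ∧ j ≤ n ∧ P i ∧ P j ∧ ∀ l, i < l → l < j → ¬ P l := by
  classical
  have hex : ∃ j, k ≤ j ∧ P j := ⟨n, hk, hn⟩
  have hi : P (Nat.findGreatest P k) := Nat.findGreatest_spec (Nat.zero_le k) h0
  have hj := Nat.find_spec hex
  refine ⟨Nat.findGreatest P k, Nat.find hex, ?_, ?_, Nat.find_le ⟨hk, hn⟩, hi, hj.2, ?_⟩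
  · exact lt_of_le_of_ne (Nat.findGreatest_le k) fun h => hPk (h ▸ hi)
  · exact lt_of_le_of_ne hj.1 fun h => hPk (h ▸ hj.2)
  · intro l hl hl'
    rcases le_total l k with h | h
    · exact Nat.findGreatest_is_greatest hl h
    · exact fun hP => Nat.find_min hex hl' ⟨h, hP⟩

/-- Quasi-geodesics with endpoints in the target of a contracting projection stay close to it. -/
theorem IsContracting.seq_near {F : M → X} {Y : Set M} {K κ R c : ℝ} (hR : 0 ≤ R) (hK : 0 ≤ K)
    (hκ : 0 ≤ κ) (hc : 0 ≤ c) (hcon : IsContracting F Y R)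
    (hF : ∀ a b, dist (F a) (F b) ≤ K * dist a b)
    (hFY : ∀ a ∈ Y, ∀ b ∈ Y, dist a b ≤ κ * dist (F a) (F b) + κ) :
    ∃ B : ℝ, 0 ≤ B ∧ ∀ (n : ℕ) (q : ℕ → M), IsQuasiGeodesicSeq c n q → q 0 ∈ Y → q n ∈ Y →
      ∀ i ≤ n, ∃ y ∈ Y, dist (q i) y ≤ B := by
  -- Far from `Y`, a block of `N` steps moves the projection by at most `R`. This `N` is large
  -- enough that the projected progress, converted back by `κ` and `c`, accounts for at most half of
  -- `j - i`. As `R` is independent of the scale, `N` can be fixed before `D₀`.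
  obtain ⟨N, hN⟩ := exists_nat_ge (2 * c * κ * R + 1)
  have hN1 : (1 : ℝ) ≤ N := le_trans (by linarith [show 0 ≤ 2 * c * κ * R by positivity]) hN
  have hNpos : 0 < N := by exact_mod_cast (zero_lt_one.trans_le hN1)
  obtain ⟨D₀, hD₀⟩ := hcon (c * N + c)
  set D := max D₀ 0 with hD
  have hD0 : 0 ≤ D := le_max_right _ _
  set Z := 2 * (c * (2 * D + (κ * (R + (4 * (K * (D + 2 * c)) + 2)) + κ)) + c) with hZ
  have hZ0 : 0 ≤ Z := by positivity
  refine ⟨D + (c * Z + c), by positivity, fun n q hq h0 hn k hk => ?_⟩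
  by_cases hnear : ∃ y ∈ Y, dist (q k) y ≤ D
  · obtain ⟨y, hy, h⟩ := hnear
    exact ⟨y, hy, h.trans (le_add_of_nonneg_right (by positivity))⟩
  obtain ⟨i, j, hik, hkj, hjn, ⟨yi, hyi, hdi⟩, ⟨yj, hyj, hdj⟩, hgap⟩ :=
    exists_maximal_gap (P := fun i => ∃ y ∈ Y, dist (q i) y ≤ D) hk
      ⟨q 0, h0, by simpa using hD0⟩ ⟨q n, hn, by simpa using hD0⟩ hnear
  choose π hπ using exists_isNearlyNearest F (Y := Y) ⟨_, h0⟩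
  have hstep : ∀ a ≤ n, ∀ b ≤ n, ∀ s : ℕ, a ≤ b → b ≤ a + s → dist (q a) (q b) ≤ c * s + c := by
    intro a ha b hb s hab hbs
    refine (hq a ha b hb).2.trans ?_
    have : |(a : ℝ) - b| ≤ s := by
      rw [abs_sub_comm, abs_of_nonneg (sub_nonneg.2 (Nat.cast_le.2 hab))]
      have : (b : ℝ) ≤ (a + s : ℕ) := Nat.cast_le.2 hbs
      push_cast at this; linarith
    gcongr
  have hblock : ∀ t l : ℕ, l ≤ t * N → i + 1 + l < j →
      dist (F (π (q (i + 1)))) (F (π (q (i + 1 + l)))) ≤ t * R := by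
    intro t
    induction t with
    | zero =>
      intro l hl _
      obtain rfl : l = 0 := by omega
      simp
    | succ t ih =>
      intro l hl hlj
      rw [Nat.succ_mul] at hl
      -- Truncated subtraction is intended: when `l < N`, the block starts at `i + 1`.
      have h1 := ih (l - N) (by omega) (by omega)
      have h2 := hD₀ (q (i + 1 + (l - N))) (q (i + 1 + l)) _ _ (hπ _) (hπ _)
        (hstep _ (by omega) _ (by omega) N (by omega) (by omega)) fun z hz => by
          by_contra! hc
          exact hgap (i + 1 + (l - N)) (by omega) (by omega) ⟨z, hz, hc.trans (le_max_left _ _)⟩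
      have h3 := dist_triangle (F (π (q (i + 1)))) (F (π (q (i + 1 + (l - N)))))
        (F (π (q (i + 1 + l))))
      push_cast
      linarith
  have hproj : ∀ g y, y ∈ Y → dist g y ≤ D + 2 * c →
      dist (F y) (F (π g)) ≤ 2 * (K * (D + 2 * c)) + 1 := by
    intro g y hy hd
    have h1 := (hπ g).2 y hy
    have h2 := (hF g y).trans (mul_le_mul_of_nonneg_left hd hK)
    have h3 := dist_triangle (F y) (F g) (F (π g))
    rw [dist_comm (F y) (F g)] at h3
    linarith
  set l := j - 1 - (i + 1) with hl
  have hlj : i + 1 + l = j - 1 := by omega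
  have e1 := hproj (q (i + 1)) yi hyi <| by
    have h1 := hstep i (by omega) (i + 1) (by omega) 1 (by omega) (by omega)
    have h2 := dist_triangle (q (i + 1)) (q i) yi
    rw [dist_comm] at h1
    push_cast at h1
    linarith
  have e2 := hproj (q (i + 1 + l)) yj hyj <| by
    have h1 := hstep (i + 1 + l) (by omega) j (by omega) 1 (by omega) (by omega)
    have h2 := dist_triangle (q (i + 1 + l)) (q j) yj
    push_cast at h1
    linarith
  have e3 := hblock (l / N + 1) l
    (by rw [add_mul, one_mul]; exact (Nat.lt_div_mul_add hNpos).le)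
    (by omega)
  have hlij : (l : ℝ) ≤ (j : ℝ) - i := by
    have : l + i ≤ j := by omega
    have : ((l + i : ℕ) : ℝ) ≤ j := Nat.cast_le.2 this
    push_cast at this; linarith
  have hlN : ((l / N + 1 : ℕ) : ℝ) * R ≤ ((j : ℝ) - i) / N * R + R := by
    have : ((l / N : ℕ) : ℝ) ≤ ((j : ℝ) - i) / N :=
      Nat.cast_div_le.trans (div_le_div_of_nonneg_right hlij (by positivity))
    push_cast
    have := mul_le_mul_of_nonneg_right this hR
    linarith
  have e4 : dist (F yi) (F yj) ≤ ((j : ℝ) - i) / N * R + (R + (4 * (K * (D + 2 * c)) + 2)) := by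
    have := dist_triangle4 (F yi) (F (π (q (i + 1)))) (F (π (q (i + 1 + l)))) (F yj)
    rw [dist_comm (F (π (q (i + 1 + l))))] at this
    linarith
  have e5 : dist (q i) (q j) ≤
      2 * D + (κ * (((j : ℝ) - i) / N * R + (R + (4 * (K * (D + 2 * c)) + 2))) + κ) := by
    have h1 := hFY yi hyi yj hyj
    have h2 := mul_le_mul_of_nonneg_left e4 hκ
    have h3 := dist_triangle4 (q i) yi yj (q j)
    rw [dist_comm yj] at h3
    linarith
  have e6 : (j : ℝ) - i ≤ c * dist (q i) (q j) + c := by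
    have := (hq i (by omega) j hjn).1
    rw [abs_sub_comm] at this
    exact (le_abs_self _).trans this
  have e7 : c * (κ * (((j : ℝ) - i) / N * R)) ≤ ((j : ℝ) - i) / 2 := by
    have hij : (0 : ℝ) ≤ (j : ℝ) - i := le_trans (Nat.cast_nonneg l) hlij
    rw [show c * (κ * (((j : ℝ) - i) / N * R)) = (((j : ℝ) - i) / 2) * ((2 * c * κ * R) / N) by ring]
    exact mul_le_of_le_one_right (by positivity) ((div_le_one (by positivity)).2 (by linarith))
  -- Absorbing the half from `e7` leaves twice the constant terms, which is `Z`.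
  have e8 : (j : ℝ) - i ≤ Z := by
    have := mul_le_mul_of_nonneg_left e5 hc
    rw [hZ]
    linarith
  refine ⟨yi, hyi, ?_⟩
  have h1 := hstep i (by omega) k hk (k - i) (by omega) (by omega)
  have h2 : ((k - i : ℕ) : ℝ) ≤ Z := by
    rw [Nat.cast_sub hik.le]
    have : (k : ℝ) ≤ j := Nat.cast_le.2 hkj.le
    linarith
  have h3 := dist_triangle (q k) (q i) yi
  rw [dist_comm (q k) (q i)] at h3
  have h4 := mul_le_mul_of_nonneg_left h2 hc
  linarith

/-- Quasi-geodesics with the same endpoints, lying in the target of a contracting projection, are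
close to each other. -/
theorem IsContracting.seq_near_seq {F : M → X} {Y : Set M} {K κ R c δ : ℝ} (hR : 0 ≤ R)
    (hK : 0 ≤ K) (hκ : 0 ≤ κ) (hc : 0 ≤ c) (hδ : 0 ≤ δ) (hX : IsGeodesicSpace X)
    (hX4 : FourPoint δ X) (hcon : IsContracting F Y R)
    (hF : ∀ a b, dist (F a) (F b) ≤ K * dist a b)
    (hFY : ∀ a ∈ Y, ∀ b ∈ Y, dist a b ≤ κ * dist (F a) (F b) + κ) :
    ∃ C : ℝ, 0 ≤ C ∧ ∀ (n n' : ℕ) (q q' : ℕ → M), IsQuasiGeodesicSeq c n q →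
      IsQuasiGeodesicSeq c n' q' → q 0 = q' 0 → q n = q' n' → q 0 ∈ Y → q n ∈ Y →
      ∀ i ≤ n, ∃ j ≤ n', dist (q i) (q' j) ≤ C := by
  obtain ⟨B, hB, hnear⟩ := hcon.seq_near hR hK hκ hc hF hFY
  set c' := c * κ + (c * (2 * B + κ) + c) + K * c + K * (2 * B + c) with hc'
  have a1 : 0 ≤ c * κ := by positivity
  have a2 : 0 ≤ c * (2 * B + κ) + c := by positivity
  have a3 : 0 ≤ K * c := by positivity
  have a4 : 0 ≤ K * (2 * B + c) := by positivity
  obtain ⟨C, hC, hmorse⟩ := hX4.seq_near_seq hX hδ (show 0 ≤ c' by positivity)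
  refine ⟨2 * B + (κ * C + κ), by positivity, fun n n' q q' hq hq' h0 hn h0Y hnY i hi => ?_⟩
  -- Endpoints are kept exactly, so the two image sequences in `X` share theirs and the Morse lemma
  -- applies.
  have push : ∀ (n : ℕ) (q : ℕ → M), IsQuasiGeodesicSeq c n q → q 0 ∈ Y → q n ∈ Y →
      ∃ y : ℕ → M, (∀ i ≤ n, y i ∈ Y ∧ dist (q i) (y i) ≤ B) ∧ y 0 = q 0 ∧ y n = q n ∧
        IsQuasiGeodesicSeq c' n (F ∘ y) := by
    intro n q hq h0 hn
    have : ∀ i, ∃ y, (i ≤ n → y ∈ Y ∧ dist (q i) y ≤ B) ∧ (i = 0 → y = q 0) ∧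
        (i = n → y = q n) := by
      intro i
      by_cases hi0 : i = 0
      · exact ⟨q i, fun _ => ⟨hi0 ▸ h0, by simpa using hB⟩, fun h => by rw [h], fun h => by rw [h]⟩
      by_cases hin : i = n
      · exact ⟨q i, fun _ => ⟨hin ▸ hn, by simpa using hB⟩, fun h => by rw [h], fun h => by rw [h]⟩
      by_cases hi : i ≤ n
      · obtain ⟨y, hy, hd⟩ := hnear n q hq h0 hn i hi
        exact ⟨y, fun _ => ⟨hy, hd⟩, fun h => absurd h hi0, fun h => absurd h hin⟩
      · exact ⟨q i, fun h => absurd h hi, fun h => absurd h hi0, fun h => absurd h hin⟩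
    choose y hy hy0 hyn using this
    refine ⟨y, hy, hy0 0 rfl, hyn n rfl, fun i hi j hj => ?_⟩
    obtain ⟨hiY, hid⟩ := hy i hi
    obtain ⟨hjY, hjd⟩ := hy j hj
    obtain ⟨hq1, hq2⟩ := hq i hi j hj
    have hnn : 0 ≤ dist (F (y i)) (F (y j)) := dist_nonneg
    have habs : 0 ≤ |(i : ℝ) - j| := abs_nonneg _
    simp only [Function.comp_apply]
    constructor
    · have h1 := dist_triangle4 (q i) (y i) (y j) (q j)
      rw [dist_comm (y j) (q j)] at h1
      have h2 := hFY _ hiY _ hjY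
      have h3 : c * dist (q i) (q j) ≤ c * (2 * B + κ * dist (F (y i)) (F (y j)) + κ) := by
        gcongr; linarith
      have h4 : (c * κ) * dist (F (y i)) (F (y j)) ≤ c' * dist (F (y i)) (F (y j)) := by
        gcongr; linarith
      linarith
    · have h1 := dist_triangle4 (y i) (q i) (q j) (y j)
      rw [dist_comm (y i) (q i)] at h1
      have h2 := hF (y i) (y j)
      have h3 : K * dist (y i) (y j) ≤ K * (2 * B + (c * |(i : ℝ) - j| + c)) := by
        gcongr; linarith
      have h4 : (K * c) * |(i : ℝ) - j| ≤ c' * |(i : ℝ) - j| := by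
        gcongr; linarith
      linarith
  obtain ⟨y, hy, hy0, hyn, hyq⟩ := push n q hq h0Y hnY
  obtain ⟨y', hy', hy0', hyn', hyq'⟩ := push n' q' hq' (h0 ▸ h0Y) (hn ▸ hnY)
  obtain ⟨j, hj, hd⟩ := hmorse n n' _ _ hyq hyq' (by simp only [Function.comp_apply, hy0, hy0', h0])
    (by simp only [Function.comp_apply, hyn, hyn', hn]) i hi
  refine ⟨j, hj, ?_⟩
  have h1 := hFY _ (hy i hi).1 _ (hy' j hj).1
  have h2 : κ * dist (F (y i)) (F (y' j)) ≤ κ * C := mul_le_mul_of_nonneg_left hd hκ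
  have h3 := dist_triangle4 (q i) (y i) (y' j) (q' j)
  rw [dist_comm (y' j)] at h3
  linarith [(hy i hi).2, (hy' j hj).2]

/-- A quasi-geodesic on a compact interval is close to a quasi-geodesic sequence with the same
endpoints. -/
theorem IsQuasiGeodesic.exists_seq {τ a b : ℝ} {γ : ℝ → M} (hab : a ≤ b)
    (hγ : IsQuasiGeodesic τ (Set.Icc a b) γ) :
    ∃ (n : ℕ) (q : ℕ → M), IsQuasiGeodesicSeq (τ * τ + 1) n q ∧ q 0 = γ a ∧ q n = γ b ∧
      (∀ i, q i ∈ γ '' Set.Icc a b) ∧ ∀ x ∈ γ '' Set.Icc a b, ∃ i ≤ n, dist x (q i) ≤ 2 * τ := by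
  obtain ⟨-, hτ, h⟩ := hγ
  have hτ0 : 0 < τ := zero_lt_one.trans_le hτ
  have hττ : τ ≤ τ * τ := le_mul_of_one_le_left hτ0.le hτ
  have h' : ∀ s ∈ Set.Icc a b, ∀ t ∈ Set.Icc a b,
      |s - t| ≤ τ * dist (γ s) (γ t) + τ * τ ∧ dist (γ s) (γ t) ≤ τ * |s - t| + τ := by
    intro s hs t ht
    obtain ⟨h1, h2⟩ := h ⟨s, hs⟩ ⟨t, ht⟩
    refine ⟨?_, h2⟩
    have h3 : τ⁻¹ * |s - t| - τ ≤ dist (γ s) (γ t) := h1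
    have h4 := mul_le_mul_of_nonneg_left h3 hτ0.le
    rw [mul_sub, mul_inv_cancel_left₀ hτ0.ne'] at h4
    linarith
  set n := ⌈b - a⌉₊ with hn
  have hmem : ∀ i : ℕ, min (a + i) b ∈ Set.Icc a b := fun i =>
    ⟨le_min (by linarith [Nat.cast_nonneg (α := ℝ) i]) hab, min_le_right _ _⟩
  refine ⟨n, fun i => γ (min (a + i) b), ?_, ?_, ?_, fun i => ⟨_, hmem i, rfl⟩, ?_⟩
  · intro i hi j hj
    obtain ⟨h1, h2⟩ := h' _ (hmem i) _ (hmem j)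
    have hd : 0 ≤ dist (γ (min (a + i) b)) (γ (min (a + j) b)) := dist_nonneg
    have habs : 0 ≤ |(i : ℝ) - j| := abs_nonneg _
    have h3 : |min (a + i) b - min (a + j) b| ≤ |(i : ℝ) - j| := by
      refine (abs_min_sub_min_le_max _ _ _ _).trans ?_
      simp
    -- Only the last sample can be truncated at `b`, by less than 1; this gives the `+ 1` in `τ * τ
    -- + 1`.
    have hlow : ∀ k ≤ n, (a + k) - 1 ≤ min (a + k : ℝ) b := by
      intro k hk
      refine le_min (by linarith) ?_
      have h5 : (n : ℝ) < b - a + 1 := Nat.ceil_lt_add_one (by linarith)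
      have h6 : (k : ℝ) ≤ n := Nat.cast_le.2 hk
      linarith
    have h4 : |(i : ℝ) - j| ≤ |min (a + i) b - min (a + j) b| + 1 := by
      have e1 := hlow i hi
      have e2 := hlow j hj
      have e3 := min_le_left (a + i : ℝ) b
      have e4 := min_le_left (a + j : ℝ) b
      obtain ⟨e5, e6⟩ := abs_le.1 (le_refl |min (a + i : ℝ) b - min (a + j) b|)
      rw [abs_le]
      constructor <;> linarith
    constructor
    · have : τ * dist (γ (min (a + i) b)) (γ (min (a + j) b)) ≤
          (τ * τ + 1) * dist (γ (min (a + i) b)) (γ (min (a + j) b)) := by gcongr; linarith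
      linarith
    · have e1 : τ * |min (a + i) b - min (a + j) b| ≤ (τ * τ + 1) * |(i : ℝ) - j| := by
        gcongr; linarith
      linarith
  · simp [hab]
  · simp only
    rw [min_eq_right]
    linarith [Nat.le_ceil (b - a)]
  · rintro _ ⟨t, ht, rfl⟩
    have e1 := Nat.floor_le (sub_nonneg.2 ht.1)
    have e2 := Nat.lt_floor_add_one (t - a)
    refine ⟨⌊t - a⌋₊, (Nat.floor_le_ceil _).trans (Nat.ceil_mono (by linarith [ht.2])), ?_⟩
    have e3 := (h' t ht _ (hmem ⌊t - a⌋₊)).2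
    have e4 : |t - min (a + (⌊t - a⌋₊ : ℝ)) b| ≤ 1 := by
      rw [min_eq_left (by linarith [ht.2]), abs_le]
      constructor <;> linarith
    have e5 := mul_le_mul_of_nonneg_left e4 hτ0.le
    linarith

end Contraction

end AQI

namespace AQI

/-! ### From acylindricity to contraction and undistortion. -/

section Action

variable {G X : Type*} [Group G] [MetricSpace X] [MulAction G X] {H : Subgroup G}

theorem exists_orbit_quasiIsometry {T : Set H} (hT : Subgroup.closure T = ⊤) {x : X}
    (h : IsQIEmbedding (fun h : WordSpace T hT => (WordSpace.of T hT).symm h • x)) :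
    ∃ κ : ℝ, 0 ≤ κ ∧ ∀ a b : H, wordDist T a b ≤ κ * dist (a • x) (b • x) + κ ∧
      dist (a • x) (b • x) ≤ κ * wordDist T a b + κ := by
  obtain ⟨τ, hτ, h⟩ := h
  have hτ0 : 0 < τ := zero_lt_one.trans_le hτ
  have hττ : τ ≤ τ * τ := le_mul_of_one_le_left hτ0.le hτ
  refine ⟨τ * τ, by positivity, fun a b => ?_⟩
  obtain ⟨h1, h2⟩ := h (WordSpace.of T hT a) (WordSpace.of T hT b)
  change τ⁻¹ * wordDist T a b - τ ≤ dist (a • x) (b • x) at h1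
  change dist (a • x) (b • x) ≤ τ * wordDist T a b + τ at h2
  have h3 := mul_le_mul_of_nonneg_left h1 hτ0.le
  rw [mul_sub, mul_inv_cancel_left₀ hτ0.ne'] at h3
  have h4 := mul_le_mul_of_nonneg_right hττ (dist_nonneg (x := a • x) (y := b • x))
  have h5 := mul_le_mul_of_nonneg_right hττ (wordDist_nonneg (S := T) a b)
  constructor <;> linarith

/-- A quasi-isometrically embedded orbit in a hyperbolic space is quasiconvex. -/
theorem quasiconvex_orbit {δ κ : ℝ} (hδ : 0 ≤ δ) (hκ : 0 ≤ κ) (hX4 : FourPoint δ X) {T : Set H}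
    (hT : Subgroup.closure T = ⊤) {x : X}
    (hqi : ∀ a b : H, wordDist T a b ≤ κ * dist (a • x) (b • x) + κ ∧
      dist (a • x) (b • x) ≤ κ * wordDist T a b + κ) :
    ∃ Q : ℝ, 0 ≤ Q ∧ ∀ y ∈ MulAction.orbit H x, ∀ y' ∈ MulAction.orbit H x, ∀ σ,
      IsGeodesic y y' σ → ∀ t ∈ Set.Icc 0 (dist y y'),
        ∃ z ∈ MulAction.orbit H x, dist (σ t) z ≤ Q := by
  obtain ⟨C, hC, h⟩ := hX4.geodesic_near_seq hδ hκ
  refine ⟨C, hC, ?_⟩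
  rintro _ ⟨a, rfl⟩ _ ⟨b, rfl⟩ σ hσ t ht
  obtain ⟨n, q, rfl, rfl, hq⟩ := exists_geodesic_seq hT a b
  obtain ⟨i, -, hd⟩ := h n (fun i => q i • x) σ
    (fun i hi j hj => by simpa only [hq i hi j hj] using hqi (q i) (q j)) hσ t ht
  exact ⟨_, ⟨q i, rfl⟩, hd⟩

variable [IsIsometricSMul G X]

theorem dist_inv_smul_left' (g : G) (a b : X) : dist (g⁻¹ • a) b = dist a (g • b) := by
  rw [← dist_smul g, smul_inv_smul]

theorem dist_mul_inv_smul (g k : G) (a : X) :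
    dist ((g * k⁻¹) • a) a = dist (k⁻¹ • a) (g⁻¹ • a) := by
  rw [mul_smul, ← dist_smul g (k⁻¹ • a), smul_inv_smul]

/-- Conditions (A) and (QI) may come with different base points. Elements of `H` preserve the
distance between the two, so only `ε` and `R` change. -/
theorem AcylindricalAlong.change_basepoint {x x' : X}
    (h : AcylindricalAlong G (MulAction.orbit H x)) :
    AcylindricalAlong G (MulAction.orbit H x') := by
  intro ε hε
  have hd : 0 ≤ dist x x' := dist_nonneg
  obtain ⟨R, hR, m, hm, hA⟩ := h (ε + 2 * dist x x') (by positivity)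
  refine ⟨R + 2 * dist x x', by positivity, m, hm, ?_⟩
  rintro _ ⟨a, rfl⟩ _ ⟨b, rfl⟩ hab
  have hH : ∀ c : H, dist (c • x) (c • x') = dist x x' := fun c => dist_smul (c : G) x x'
  refine (Set.encard_le_encard ?_).trans (hA (a • x) ⟨a, rfl⟩ (b • x) ⟨b, rfl⟩ ?_)
  · rintro g ⟨h1, h2⟩
    have key : ∀ c : H, dist (g • c • x') (c • x') ≤ ε →
        dist (g • c • x) (c • x) ≤ ε + 2 * dist x x' := by
      intro c hc
      have e := dist_triangle4 (g • c • x) (g • c • x') (c • x') (c • x)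
      rw [dist_smul, hH, dist_comm (c • x'), hH] at e
      linarith
    exact ⟨key a h1, key b h2⟩
  · have e := dist_triangle4 (a • x') (a • x) (b • x) (b • x')
    rw [dist_comm (a • x') (a • x), hH, hH] at e
    simp only at hab
    linarith

/-- If the action is acylindrical along an orbit, only finitely many translates of a given
segment pass close to two fixed distant points of the orbit. -/
theorem AcylindricalAlong.finite_translates {δ : ℝ} (hδ : 0 ≤ δ) (hX4 : FourPoint δ X) {x : X}
    (hA : AcylindricalAlong G (MulAction.orbit H x)) {C : ℝ} (hC : 0 ≤ C) :
    ∃ R : ℝ, 0 < R ∧ ∀ (w : G) (η : H), R ≤ dist x (η • x) →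
      {k : G | dist (k • x) x + dist x ((k * w) • x) ≤ dist x (w • x) + C ∧
        dist (k • x) (η • x) + dist (η • x) ((k * w) • x) ≤ dist x (w • x) + C}.Finite := by
  obtain ⟨R, hR, m, -, hm⟩ := hA (C + 1 + δ) (by positivity)
  refine ⟨R, hR, fun w η hη => ?_⟩
  set A := {k : G | dist (k • x) x + dist x ((k * w) • x) ≤ dist x (w • x) + C ∧
    dist (k • x) (η • x) + dist (η • x) ((k * w) • x) ≤ dist x (w • x) + C}
  have hfin := Set.finite_of_encard_le_coe (hm x ⟨1, one_smul _ x⟩ (η • x) ⟨η, rfl⟩ hη)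
  -- Finitely many classes. For `k`, `k₀` in one class and `p` either orbit point, `k⁻¹ • p` and
  -- `k₀⁻¹ • p` lie almost on one segment at almost the same distance from `x`, so `k * k₀⁻¹` barely
  -- moves `p` and acylindricity applies.
  let φ : G → ℕ × ℕ := fun k => (⌊dist (k • x) x⌋₊, ⌊dist (k • x) (η • x)⌋₊)
  refine Set.Finite.of_finite_fibers (f := φ) ?_ ?_
  · refine ((Set.finite_Iic ⌊dist x (w • x) + C⌋₊).prod
      (Set.finite_Iic ⌊dist x (w • x) + C⌋₊)).subset ?_
    rintro _ ⟨k, ⟨h1, h2⟩, rfl⟩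
    exact ⟨Nat.floor_mono (le_trans (le_add_of_nonneg_right dist_nonneg) h1),
      Nat.floor_mono (le_trans (le_add_of_nonneg_right dist_nonneg) h2)⟩
  · rintro _ ⟨k₀, ⟨h1, h2⟩, rfl⟩
    refine (hfin.image (· * k₀)).subset ?_
    rintro k ⟨⟨h3, h4⟩, hφ⟩
    obtain ⟨hφ1, hφ2⟩ := Prod.ext_iff.1 (Set.mem_singleton_iff.1 hφ)
    have hfl : ∀ {r s : ℝ}, 0 ≤ r → 0 ≤ s → ⌊r⌋₊ = ⌊s⌋₊ → |s - r| ≤ 1 := by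
      intro r s hr hs h
      have e1 := Nat.floor_le hr
      have e2 := Nat.lt_floor_add_one r
      have e3 := Nat.floor_le hs
      have e4 := Nat.lt_floor_add_one s
      rw [h] at e1 e2
      rw [abs_le]
      constructor <;> linarith
    have key : ∀ p : X, dist (k₀ • x) p + dist p ((k₀ * w) • x) ≤ dist x (w • x) + C →
        dist (k • x) p + dist p ((k * w) • x) ≤ dist x (w • x) + C →
        ⌊dist (k • x) p⌋₊ = ⌊dist (k₀ • x) p⌋₊ → dist ((k * k₀⁻¹) • p) p ≤ C + 1 + δ := by
      intro p e1 e2 e3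
      rw [dist_mul_inv_smul]
      have tr : ∀ g : G, dist x (g⁻¹ • p) = dist (g • x) p ∧
          dist (g⁻¹ • p) (w • x) = dist p ((g * w) • x) := fun g =>
        ⟨by rw [dist_comm, dist_inv_smul_left', dist_comm],
          by rw [dist_inv_smul_left', mul_smul]⟩
      refine hX4.dist_le_of_between (x := x) (z := w • x) ?_ ?_ ?_
      · rwa [(tr k₀).1, (tr k₀).2]
      · rwa [(tr k).1, (tr k).2]
      · rw [(tr k₀).1, (tr k).1]
        exact hfl dist_nonneg dist_nonneg e3
    exact ⟨k * k₀⁻¹, ⟨key x h1 h3 hφ1, key (η • x) h2 h4 hφ2⟩, by simp⟩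

/-- The closest point projection in `X` to the orbit of `H`, pulled back to the group, is
contracting. -/
theorem isContracting_orbit {δ κ : ℝ} (hδ : 0 ≤ δ) (hκ : 0 ≤ κ) (hX : IsGeodesicSpace X)
    (hX4 : FourPoint δ X) {T : Set H} (hT : Subgroup.closure T = ⊤) (hTfin : T.Finite) {x : X}
    (hqi : ∀ a b : H, wordDist T a b ≤ κ * dist (a • x) (b • x) + κ ∧
      dist (a • x) (b • x) ≤ κ * wordDist T a b + κ)
    (hA : AcylindricalAlong G (MulAction.orbit H x))
    {S : Set G} (hS : Subgroup.closure S = ⊤) (hSfin : S.Finite) {K : ℝ} (hK0 : 0 ≤ K)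
    (hK : ∀ g g' : G, dist (g • x) (g' • x) ≤ K * wordDist S g g') :
    ∃ R : ℝ, 0 ≤ R ∧ IsContracting
      (fun g : WordSpace S hS => (WordSpace.of S hS).symm g • x)
      {g | (WordSpace.of S hS).symm g ∈ H} R := by
  obtain ⟨Q, hQ, hconv⟩ := quasiconvex_orbit hδ hκ hX4 hT hqi
  set C := 4 * (δ + Q + 1) + δ with hC
  obtain ⟨R, hR, hfin⟩ := hA.finite_translates hδ hX4 (show 0 ≤ C by positivity)
  -- `R` is what acylindricity needs and `C` exceeds the threshold of `FourPoint.projection`;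
  -- neither involves `L`.
  refine ⟨max R C, hR.le.trans (le_max_left _ _), fun L => ?_⟩
  -- Used with `w = g⁻¹ * g'`, `η = h⁻¹ * h'` and `k = h⁻¹ * g`. Finite balls in `G` and `H` leave
  -- finitely many `w` and `η`, so `D` can bound the word length of every `k`.
  set A : Set G := ⋃ w ∈ {w : G | wordDist S 1 w ≤ L},
    ⋃ η ∈ {η : H | wordDist T 1 η ≤ κ * (K * L + C) + κ ∧ R ≤ dist x (η • x)},
      {k : G | dist (k • x) x + dist x ((k * w) • x) ≤ dist x (w • x) + C ∧
        dist (k • x) (η • x) + dist (η • x) ((k * w) • x) ≤ dist x (w • x) + C} with hAdef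
  have hAfin : A.Finite :=
    (finite_wordDist_le hS hSfin L).biUnion fun w _ =>
      ((finite_wordDist_le hT hTfin _).subset fun η hη => hη.1).biUnion fun η hη =>
        hfin w η hη.2
  obtain ⟨D, hD⟩ := (hAfin.image fun k => wordDist S k 1).bddAbove
  refine ⟨D, ?_⟩
  intro (g : G) (g' : G) (h : G) (h' : G) ⟨hh, hnear⟩ ⟨hh', hnear'⟩ hgg hfar
  change h ∈ H at hh
  change h' ∈ H at hh'
  change dist (h • x) (h' • x) ≤ max R C
  change wordDist S g g' ≤ L at hgg
  by_contra! hlt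
  have hproj := hX4.projection hX hδ hconv (a := g • x) (a' := g' • x) (p := h • x) (p' := h' • x)
    ⟨⟨h, hh⟩, rfl⟩ ⟨⟨h', hh'⟩, rfl⟩
    (by rintro _ ⟨z, rfl⟩; exact hnear (z : G) z.2)
    (by rintro _ ⟨z, rfl⟩; exact hnear' (z : G) z.2)
    (by have := (le_max_right R C).trans_lt hlt; linarith)
  have hmem : h⁻¹ * g ∈ A := by
    have hη : (⟨h, hh⟩⁻¹ * ⟨h', hh'⟩ : H) • x = (h⁻¹ * h') • x := rfl
    have tr : ∀ a b : G, dist ((h⁻¹ * a) • x) ((h⁻¹ * b) • x) = dist (a • x) (b • x) :=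
      fun a b => by rw [mul_smul, mul_smul, dist_smul]
    have tr1 : ∀ b : G, dist x ((h⁻¹ * b) • x) = dist (h • x) (b • x) :=
      fun b => by simpa using tr h b
    have tr2 : ∀ b : G, dist ((h⁻¹ * b) • x) x = dist (b • x) (h • x) :=
      fun b => by simpa using tr b h
    have hw : dist x ((g⁻¹ * g') • x) = dist (g • x) (g' • x) := by
      rw [mul_smul, dist_comm, dist_inv_smul_left', dist_comm]
    have hgL : dist (g • x) (g' • x) ≤ K * L := (hK g g').trans (by gcongr)
    have n1 : 0 ≤ dist (g • x) (h • x) := dist_nonneg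
    have n2 : 0 ≤ dist (h' • x) (g' • x) := dist_nonneg
    refine Set.mem_biUnion (x := g⁻¹ * g') ?_
      (Set.mem_biUnion (x := (⟨h, hh⟩⁻¹ * ⟨h', hh'⟩ : H)) ⟨?_, ?_⟩ ⟨?_, ?_⟩)
    · have := wordDist_mul_left hS g⁻¹ g g'
      rw [inv_mul_cancel] at this
      exact this.trans_le hgg
    · refine (hqi 1 _).1.trans ?_
      rw [one_smul, hη, tr1]
      gcongr
      linarith
    · rw [hη, tr1]
      exact ((le_max_left R C).trans_lt hlt).le
    · have := dist_triangle (h • x) (h' • x) (g' • x)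
      rw [mul_assoc, mul_inv_cancel_left, tr1, tr2, hw]
      linarith
    · have := dist_triangle (g • x) (h • x) (h' • x)
      rw [mul_assoc, mul_inv_cancel_left, hη, tr, tr, hw]
      linarith
  have h1 := hD ⟨_, hmem, rfl⟩
  have h2 : D < wordDist S g h := hfar h hh
  have h3 := wordDist_mul_left hS h⁻¹ g h
  rw [inv_mul_cancel] at h3
  simp only at h1
  linarith

/-- Word distance in `H` is controlled by distance in `X`, which is controlled by word distance in
`G`; changing generators of `H` costs the factor `K₁`. -/
theorem isUndistorted_of_orbit {κ : ℝ} (hκ : 0 ≤ κ) {T : Set H} (hT : Subgroup.closure T = ⊤)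
    {x : X} (hqi : ∀ a b : H, wordDist T a b ≤ κ * dist (a • x) (b • x) + κ) (hTfin : T.Finite) :
    IsUndistorted H := by
  intro T' hT' S hS hT'fin hSfin
  obtain ⟨K, hK0, hK⟩ := exists_dist_le_mul_wordDist hS hSfin (fun g : G => g • x)
    (fun g a b => by simp only [mul_smul, dist_smul])
  obtain ⟨K₁, hK₁0, hK₁⟩ := exists_dist_le_mul_wordDist hT hTfin (fun h => WordSpace.of T' hT' h)
    (fun g a b => wordDist_mul_left hT' g a b)
  obtain ⟨K₂, hK₂0, hK₂⟩ := exists_dist_le_mul_wordDist hT' hT'fin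
    (fun h => WordSpace.of S hS (h : G)) (fun g a b => wordDist_mul_left hS (g : G) a b)
  set τ := K₁ * (κ * K) + K₁ * κ + K₂ + 1 with hτ
  have p1 : 0 ≤ K₁ * (κ * K) := by positivity
  have p2 : 0 ≤ K₁ * κ := by positivity
  have hτ1 : 1 ≤ τ := by linarith
  have hτ0 : 0 < τ := by linarith
  refine ⟨τ, hτ1, fun (a : H) (b : H) => ?_⟩
  change τ⁻¹ * wordDist T' a b - τ ≤ wordDist S (a : G) b ∧
    wordDist S (a : G) b ≤ τ * wordDist T' a b + τ
  have e1 : wordDist T' a b ≤ K₁ * wordDist T a b := hK₁ a b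
  have e2 : wordDist S (a : G) b ≤ K₂ * wordDist T' a b := hK₂ a b
  have e3 : dist (a • x) (b • x) ≤ K * wordDist S (a : G) b := hK a b
  have n1 := wordDist_nonneg (S := T') a b
  have n2 := wordDist_nonneg (S := S) (a : G) b
  constructor
  · have e4 : wordDist T' a b ≤ K₁ * (κ * (K * wordDist S (a : G) b) + κ) :=
      e1.trans (mul_le_mul_of_nonneg_left ((hqi a b).trans (by gcongr)) hK₁0)
    have e5 : K₁ * (κ * K) * wordDist S (a : G) b ≤ τ * wordDist S (a : G) b := by
      gcongr; linarith
    have e6 : τ ≤ τ * τ := le_mul_of_one_le_left hτ0.le hτ1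
    rw [sub_le_iff_le_add, inv_mul_le_iff₀ hτ0]
    linarith
  · have e4 : K₂ * wordDist T' a b ≤ τ * wordDist T' a b := by
      gcongr; linarith
    linarith

end Action

end AQI

theorem theorem1p3 {G X : Type*} [Group G] [MetricSpace X] [MulAction G X]
    [IsIsometricSMul G X] (H : Subgroup G) (hG : Group.FG G)
    (hAQI : AQI.IsAQITriple G X H) : AQI.IsStable H := by
  open AQI in
  obtain ⟨⟨hX, δ₀, hslim⟩, hH, -, ⟨x₀, hA₀⟩, T, hT, x, hTfin, hqi₀⟩ := hAQI
  have hδ : 0 ≤ 4 * δ₀ + 4 := by linarith [hslim.nonneg x]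
  have hX4 := hslim.fourPoint hX
  have hA : AcylindricalAlong G (MulAction.orbit H x) := hA₀.change_basepoint
  obtain ⟨κ, hκ, hqi⟩ := exists_orbit_quasiIsometry hT hqi₀
  have hund := isUndistorted_of_orbit hκ hT (fun a b => (hqi a b).1) hTfin
  refine ⟨hG, hH, hund, fun S hS hSfin τ hτ => ?_⟩
  obtain ⟨K, hK0, hK⟩ := exists_dist_le_mul_wordDist hS hSfin (fun g : G => g • x)
    (fun g a b => by simp only [mul_smul, dist_smul])
  obtain ⟨K₂, hK₂0, hK₂⟩ := exists_dist_le_mul_wordDist hT hTfin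
    (fun h => WordSpace.of S hS (h : G)) (fun g a b => wordDist_mul_left hS (g : G) a b)
  obtain ⟨R, hR, hcon⟩ := isContracting_orbit hδ hκ hX hX4 hT hTfin hqi hA hS hSfin hK0 hK
  obtain ⟨C, hC, hclose⟩ := hcon.seq_near_seq (κ := K₂ * κ) (c := τ * τ + 1) hR hK0
    (by positivity) (by positivity) hδ hX hX4 (fun a b => hK a b) fun a ha b hb => by
      have e1 : dist a b ≤ K₂ * wordDist T ⟨_, ha⟩ ⟨_, hb⟩ := hK₂ ⟨_, ha⟩ ⟨_, hb⟩
      refine e1.trans ((mul_le_mul_of_nonneg_left (hqi _ _).1 hK₂0).trans_eq ?_)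
      rw [mul_add, ← mul_assoc]
      rfl
  -- `2 * τ` pays for replacing a point by a sample, `C` for passing to the other sequence.
  have hL : 0 ≤ 2 * τ + C := by positivity
  obtain ⟨L, hL⟩ : ∃ L : NNReal, (L : ℝ) = 2 * τ + C := ⟨⟨_, hL⟩, rfl⟩
  refine ⟨L, fun a b a' b' γ γ' hab hab' hγ hγ' hstart hend haH hbH => ?_⟩
  have key : ∀ (a b a' b' : ℝ) (γ γ' : ℝ → WordSpace S hS), a ≤ b → a' ≤ b' →
      IsQuasiGeodesic τ (Set.Icc a b) γ → IsQuasiGeodesic τ (Set.Icc a' b') γ' →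
      γ a = γ' a' → γ b = γ' b' →
      (WordSpace.of S hS).symm (γ a) ∈ H → (WordSpace.of S hS).symm (γ b) ∈ H →
      ∀ y ∈ γ '' Set.Icc a b, ∃ z ∈ γ' '' Set.Icc a' b', edist y z ≤ (L : ENNReal) := by
    intro a b a' b' γ γ' hab hab' hγ hγ' hstart hend haH hbH y hy
    obtain ⟨n, q, hq, hq0, hqn, -, hcov⟩ := hγ.exists_seq hab
    obtain ⟨n', q', hq', hq0', hqn', hq'mem, -⟩ := hγ'.exists_seq hab'
    obtain ⟨i, hi, hyi⟩ := hcov y hy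
    obtain ⟨j, -, hij⟩ := hclose n n' q q' hq hq' (by rw [hq0, hq0', hstart])
      (by rw [hqn, hqn', hend]) (hq0 ▸ haH) (hqn ▸ hbH) i hi
    refine ⟨q' j, hq'mem j, ?_⟩
    rw [edist_nndist, ENNReal.coe_le_coe, ← NNReal.coe_le_coe, coe_nndist, hL]
    exact (dist_triangle _ (q i) _).trans (add_le_add hyi hij)
  exact Metric.hausdorffEDist_le_of_mem_edist
    (key a b a' b' γ γ' hab hab' hγ hγ' hstart hend haH hbH)
    (key a' b' a b γ' γ hab' hab hγ' hγ hstart.symm hend.symm (hstart ▸ haH) (hend ▸ hbH))
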